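/- Let $d\ge 1$ and let $\mathbb R^d$ carry the Euclidean scalar product $\langle\cdot,\cdot\rangle$, norm $\|\cdot\|$ and closed unit ball $B$. For $K\subset\{1,\dots,d\}$ let $x_K$ be the vector which coincides with $x$ on $K$ and vanishes outside $K$. For $k=0,1,\dots,d$ put $\|x\|_{(k)}^{\mathrm{sgn}}=\sup_{|K|\le k}\|x_K\|$ (so $\|\cdot\|_{(0)}^{\mathrm{sgn}}=0$). For $l=1,\dots,d$ let $\|\cdot\|_{(l)}^{\mathrm{sn}}$ be the $l$-support norm, i.e. the dual norm $\|x\|_{(l)}^{\mathrm{sn}}=\sup\{\langle y,x\rangle : \|y\|_{(l)}^{\mathrm{sgn}}\le 1\}$, and let $B_{(l)}$ be its closed unit ball; put $B_{(0)}=\{0\}$. Let $\mathcal L_0:\mathbb R^d\to[-\infty,+\infty]$ be the Fenchel conjugate $$\mathcal L_0(x)=\sup_{y\in\mathbb R^d}\Bigl(\langle x,y\rangle-\sup_{l=0,1,\dots,d}\bigl(\|y\|_{(l)}^{\mathrm{sgn}}-l\bigr)\Bigr).$$ Then $B_{(0)}\subset B_{(1)}\subset\cdots\subset B_{(d)}=B$,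 and: 1. The epigraph $\mathrm{epi}\,\mathcal L_0=\{(x,t)\in\mathbb R^d\times\mathbb R:\mathcal L_0(x)\le t\}$ is the closed convex hull $$\mathrm{epi}\,\mathcal L_0=\overline{\mathrm{co}}\Bigl(\bigcup_{l=0}^d B_{(l)}\times[l,+\infty)\Bigr).$$ 2. Let $L_0$ be the (well-defined) function on $\mathbb R^d$ with $L_0(0)=0$, $L_0(x)=l$ if $x\in B_{(l)}\setminus B_{(l-1)}$ for $l=1,\dots,d$, and $L_0(x)=+\infty$ if $x\notin B$. Then $\mathcal L_0$ is the largest proper convex lower semicontinuous function $\mathbb R^d\to[-\infty,+\infty]$ that is pointwise $\le L_0$ (in particular $\mathcal L_0$ itself is proper, convex and lower semicontinuous). 3. For every $x\in\mathbb R^d$, $$\mathcal L_0(x)=\min\Bigl\{\sum_{l=1}^d l\,\|x^{(l)}\|_{(l)}^{\mathrm{sn}} \;:\; x^{(1)},\dots,x^{(d)}\in\mathbb R^d,\ \sum_{l=1}^d\|x^{(l)}\|_{(l)}^{\mathrm{sn}}\le 1,\ \sum_{l=1}^d x^{(l)}=x\Bigr\},$$ where the minimum is attained whenever the constraint set is nonempty,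 and equals $+\infty$ when it is empty. -/

import Mathlib

namespace Capra

noncomputable section

/-- Euclidean space `ℝ^d`. -/
abbrev E (d : ℕ) : Type := EuclideanSpace ℝ (Fin d)

/-- `x_K`: the vector that coincides with `x` on `K` and vanishes outside `K`. -/
def restrict {d : ℕ} (K : Finset (Fin d)) (x : E d) : E d :=
  WithLp.toLp 2 (fun i => if i ∈ K then x i else 0)

/-- The `2`-`k`-symmetric gauge norm `sup_{|K| ≤ k} ‖x_K‖`. For `k = 0` only `K = ∅` is allowed
and the value is `0`. -/
def gaugeNorm {d : ℕ} (k : ℕ) (x : E d) : ℝ :=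
  ⨆ K : {K : Finset (Fin d) // K.card ≤ k}, ‖restrict K.1 x‖

/-- The `k`-support norm (`1 ≤ k ≤ d`): the dual norm of the `2`-`k`-symmetric gauge norm. -/
def supportNorm {d : ℕ} (k : ℕ) (x : E d) : ℝ :=
  sSup ((fun y : E d => inner ℝ y x) '' {y : E d | gaugeNorm k y ≤ 1})

/-- The unit ball of the `l`-support norm, with the convention that it is `{0}` for `l = 0`. -/
def supportBall (d : ℕ) (l : ℕ) : Set (E d) :=
  if l = 0 then {0} else {x | supportNorm l x ≤ 1}

/-- The Fenchel conjugate on `ℝ^d` (in `EReal`, `⊥ + ⊤ = ⊥`, which is the lower addition). -/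
def fenchelConjugate {d : ℕ} (g : E d → EReal) (x : E d) : EReal :=
  ⨆ y : E d, ((inner ℝ x y : ℝ) : EReal) + (-g y)

/-- `𝓛₀`, the Fenchel conjugate of `y ↦ sup_{l = 0, …, d} (gaugeNorm l y - l)`. -/
def calL0 (d : ℕ) : E d → EReal :=
  fenchelConjugate (fun y => ⨆ l : Fin (d + 1), ((gaugeNorm (l : ℕ) y - (l : ℕ) : ℝ) : EReal))

/-- Epigraph of an extended-real-valued function. -/
def epigraph {X : Type*} (f : X → EReal) : Set (X × ℝ) :=
  {p | f p.1 ≤ (p.2 : EReal)}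

/-- Proper: never `-∞`, and somewhere `< +∞`. -/
def IsProper {X : Type*} (f : X → EReal) : Prop :=
  (∀ x, ⊥ < f x) ∧ ∃ x, f x < ⊤

/-- Proper, convex (i.e. with convex epigraph) and lower semicontinuous. -/
def IsProperConvexLsc {d : ℕ} (f : E d → EReal) : Prop :=
  IsProper f ∧ Convex ℝ (epigraph f) ∧ LowerSemicontinuous f

open Classical in
/-- The step function `L₀`: `0` at `0`, `l` on `B_(l) ∖ B_(l-1)` for `l = 1, …, d`, and `+∞`
elsewhere. -/
def stepL0 (d : ℕ) (x : E d) : EReal :=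
  if x = 0 then 0
  else if h : ∃ l : ℕ, 1 ≤ l ∧ l ≤ d ∧ x ∈ supportBall d l \ supportBall d (l - 1) then
    ((Nat.find h : ℝ) : EReal)
  else ⊤

/-- Families `x^(1), …, x^(d)` with `∑ ‖x^(l)‖_(l) ≤ 1` and `∑ x^(l) = x`; the entry of index
`i : Fin d` is `x^(i+1)`. -/
def decompositions {d : ℕ} (x : E d) : Set (Fin d → E d) :=
  {z | ∑ i : Fin d, supportNorm ((i : ℕ) + 1) (z i) ≤ 1 ∧ ∑ i : Fin d, z i = x}

/-- The cost `∑ l ‖x^(l)‖_(l)` of a family `x^(1), …, x^(d)`. -/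
def cost {d : ℕ} (z : Fin d → E d) : ℝ :=
  ∑ i : Fin d, ((i : ℕ) + 1 : ℝ) * supportNorm ((i : ℕ) + 1) (z i)

end

end Capra

/-!
The sets `B_(l) × [l, +∞)` together form the epigraph of `L₀`. Since the gauge norm
`‖·‖_(l)^sgn` is the support function of `B_(l)`, the conjugate of `L₀` is
`y ↦ sup_l (‖y‖_(l)^sgn - l)`, so `𝓛₀` is the biconjugate of `L₀`, and the Fenchel–Moreau theorem
identifies its epigraph with the closed convex hull of the epigraph of `L₀`.

For the minimum formula, let `V` be the set of all `(x, t)` such that `x` has an admissible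
decomposition of cost at most `t`. It is convex because the support norms are, closed because the
admissible families form a compact set, and it contains the epigraph of `L₀`; hence it contains the
epigraph of `𝓛₀`. Conversely, `⟨x^(l), y⟩ ≤ ‖x^(l)‖_(l)^sn ‖y‖_(l)^sgn` shows that every affine
minorant of `L₀` lies below the cost of every decomposition, so the two sets are equal.
-/

namespace Capra

open Set

section Epigraph

variable {X : Type*}

theorem le_iff_epigraph_subset {f g : X → EReal} : f ≤ g ↔ epigraph g ⊆ epigraph f := by
  refine ⟨fun h p hp => (h p.1).trans hp, fun h x => ?_⟩
  exact EReal.le_of_forall_lt_iff_le.1 fun t ht => h (a := (x, t)) ht.le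

theorem lowerSemicontinuous_iff_isClosed_epigraph [TopologicalSpace X] {f : X → EReal} :
    LowerSemicontinuous f ↔ IsClosed (epigraph f) := by
  constructor
  · intro hf
    exact hf.isClosed_epigraph.preimage
      (continuous_id.prodMap continuous_coe_real_ereal : Continuous (Prod.map id Real.toEReal))
  · intro hf
    refine lowerSemicontinuous_iff_isClosed_preimage.2 fun c => ?_
    have hsublevel : f ⁻¹' Iic c =
        ⋂ (t : ℝ) (_ : c < t), (fun x => (x, t)) ⁻¹' epigraph f := by
      ext x
      simpa [epigraph] using EReal.le_of_forall_lt_iff_le.symm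
    rw [hsublevel]
    exact isClosed_iInter fun t => isClosed_iInter fun _ => hf.preimage (by fun_prop)

end Epigraph

section Separation

variable {H : Type*} [NormedAddCommGroup H] [InnerProductSpace ℝ H] [CompleteSpace H]

theorem exists_forall_eq_inner_add_mul (φ : StrongDual ℝ (H × ℝ)) :
    ∃ (y : H) (a : ℝ), ∀ p : H × ℝ, φ p = inner ℝ y p.1 + a * p.2 := by
  refine ⟨(InnerProductSpace.toDual ℝ H).symm (φ.comp (.inl ℝ H ℝ)), φ (0, 1), fun p => ?_⟩
  have hp : p = (p.1, 0) + p.2 • ((0 : H), (1 : ℝ)) := by ext <;> simp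
  rw [InnerProductSpace.toDual_symm_apply]
  conv_lhs => rw [hp, map_add, map_smul, smul_eq_mul, mul_comm]
  rfl

theorem nonpos_of_forall_add_mul_lt {X : Type*} {S : Set (X × ℝ)} {g : X → ℝ} {a u : ℝ}
    (hne : S.Nonempty) (hup : ∀ p ∈ S, ∀ r : ℝ, 0 ≤ r → (p.1, p.2 + r) ∈ S)
    (hS : ∀ p ∈ S, g p.1 + a * p.2 < u) : a ≤ 0 := by
  obtain ⟨p, hp⟩ := hne
  by_contra! hpos
  have hr := hS _ (hup p hp ((u - (g p.1 + a * p.2)) / a)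
    (div_nonneg (sub_nonneg.2 (hS p hp).le) hpos.le))
  dsimp only at hr
  rw [mul_add, mul_div_cancel₀ _ hpos.ne'] at hr
  linarith

theorem exists_inner_sub_le_of_notMem_closedConvexHull {S : Set (H × ℝ)} {y₀ : H} {u₀ : ℝ}
    (hne : S.Nonempty) (hup : ∀ p ∈ S, ∀ r : ℝ, 0 ≤ r → (p.1, p.2 + r) ∈ S)
    (hminorant : ∀ p ∈ S, inner ℝ y₀ p.1 - p.2 ≤ u₀) {q : H × ℝ}
    (hq : q ∉ closedConvexHull ℝ S) :
    ∃ (y : H) (u : ℝ), (∀ p ∈ S, inner ℝ y p.1 - p.2 ≤ u) ∧ q.2 < inner ℝ y q.1 - u := by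
  obtain ⟨φ, u, hS, hu⟩ :=
    geometric_hahn_banach_closed_point convex_closedConvexHull isClosed_closedConvexHull hq
  obtain ⟨y, a, hφ⟩ := exists_forall_eq_inner_add_mul φ
  replace hS (p) (hp : p ∈ S) : inner ℝ y p.1 + a * p.2 < u :=
    hφ p ▸ hS p (subset_closedConvexHull hp)
  rw [hφ] at hu
  rcases (nonpos_of_forall_add_mul_lt hne hup hS).lt_or_eq with hneg | rfl
  · have hc : 0 < (-a)⁻¹ := inv_pos.2 (neg_pos.2 hneg)
    have hscale (p : H × ℝ) :
        inner ℝ ((-a)⁻¹ • y) p.1 - p.2 = (-a)⁻¹ * (inner ℝ y p.1 + a * p.2) := by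
      have hne : a ≠ 0 := hneg.ne
      rw [real_inner_smul_left]
      field
    refine ⟨(-a)⁻¹ • y, (-a)⁻¹ * u, fun p hp => ?_, lt_sub_comm.1 ?_⟩
    · rw [hscale]
      exact mul_le_mul_of_nonneg_left (hS p hp).le hc.le
    · rw [hscale]
      exact mul_lt_mul_of_pos_left hu hc
  -- The separating hyperplane is vertical: add a large multiple of it to the given minorant.
  · simp only [zero_mul, add_zero] at hS hu
    obtain ⟨n, hn⟩ := exists_lt_nsmul (sub_pos.2 hu) (q.2 - (inner ℝ y₀ q.1 - u₀))
    rw [nsmul_eq_mul] at hn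
    refine ⟨y₀ + (n : ℝ) • y, u₀ + n * u, fun p hp => ?_, ?_⟩ <;>
      rw [inner_add_left, real_inner_smul_left]
    · have hnp := mul_le_mul_of_nonneg_left (hS p hp).le n.cast_nonneg
      linarith [hminorant p hp]
    · linarith

end Separation

section FenchelConjugate

variable {d : ℕ} {f : E d → EReal}

theorem coe_add_neg_le_coe_iff {a u : ℝ} {b : EReal} :
    (a : EReal) + -b ≤ u ↔ ∀ t : ℝ, b ≤ t → a - t ≤ u := by
  induction b with
  | bot =>
    simp only [EReal.neg_bot, EReal.coe_add_top, top_le_iff, EReal.coe_ne_top, bot_le,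
      true_imp_iff, false_iff, not_forall, not_le]
    exact ⟨a - u - 1, by linarith⟩
  | top => simp
  | coe b =>
    norm_cast
    exact ⟨fun h t ht => by linarith, fun h => by linarith [h b le_rfl]⟩

theorem fenchelConjugate_le_coe_iff {y : E d} {u : ℝ} :
    fenchelConjugate f y ≤ u ↔ ∀ p ∈ epigraph f, inner ℝ y p.1 - p.2 ≤ u := by
  simp only [fenchelConjugate, iSup_le_iff, coe_add_neg_le_coe_iff, Prod.forall]
  rfl

theorem isClosed_epigraph_fenchelConjugate : IsClosed (epigraph (fenchelConjugate f)) := by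
  simp only [epigraph, fenchelConjugate_le_coe_iff, ofPred_forall]
  exact isClosed_biInter fun p _ => isClosed_le (by fun_prop) (by fun_prop)

theorem convex_epigraph_fenchelConjugate : Convex ℝ (epigraph (fenchelConjugate f)) := by
  have hlin (p : E d × ℝ) : IsLinearMap ℝ fun q : E d × ℝ => inner ℝ q.1 p.1 - q.2 :=
    { map_add := fun q r => by simp only [Prod.fst_add, Prod.snd_add, inner_add_left]; ring
      map_smul := fun c q => by
        simp only [Prod.smul_fst, Prod.smul_snd, real_inner_smul_left, smul_eq_mul]; ring }
  simp only [epigraph, fenchelConjugate_le_coe_iff, ofPred_forall]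
  refine convex_iInter₂ fun p _ => ?_
  simpa only [sub_le_comm] using convex_halfSpace_le (hlin p) p.2

theorem fenchelConjugate_fenchelConjugate_le : fenchelConjugate (fenchelConjugate f) ≤ f := by
  refine le_iff_epigraph_subset.2 fun p hp => fenchelConjugate_le_coe_iff.2 fun q hq => ?_
  rw [real_inner_comm, sub_le_comm]
  exact fenchelConjugate_le_coe_iff.1 hq p hp

theorem bot_lt_fenchelConjugate (hf : ∃ x, f x < ⊤) (y : E d) : ⊥ < fenchelConjugate f y := by
  obtain ⟨x, hx⟩ := hf
  have hterm : ⊥ < ((inner ℝ y x : ℝ) : EReal) + -f x :=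
    EReal.bot_lt_add_iff.2
      ⟨EReal.bot_lt_coe _, bot_lt_iff_ne_bot.2 (mt EReal.neg_eq_bot_iff.1 hx.ne)⟩
  exact hterm.trans_le (le_iSup (fun x => ((inner ℝ y x : ℝ) : EReal) + -f x) x)

theorem epigraph_fenchelConjugate_fenchelConjugate (hf : ∃ x, f x < ⊤)
    (hf' : ∃ y, fenchelConjugate f y < ⊤) :
    epigraph (fenchelConjugate (fenchelConjugate f)) = closedConvexHull ℝ (epigraph f) := by
  refine Subset.antisymm (fun q hq => ?_) (closedConvexHull_min
    (le_iff_epigraph_subset.1 fenchelConjugate_fenchelConjugate_le)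
    convex_epigraph_fenchelConjugate isClosed_epigraph_fenchelConjugate)
  obtain ⟨x, hx⟩ := hf
  obtain ⟨t, hxt, -⟩ := EReal.lt_iff_exists_real_btwn.1 hx
  obtain ⟨y₀, hy₀⟩ := hf'
  obtain ⟨u₀, hyu, -⟩ := EReal.lt_iff_exists_real_btwn.1 hy₀
  by_contra hnot
  obtain ⟨y, u, hminorant, hlt⟩ := exists_inner_sub_le_of_notMem_closedConvexHull
    ⟨(x, t), hxt.le⟩
    (fun p hp r hr => hp.trans (EReal.coe_le_coe_iff.2 (le_add_of_nonneg_right hr)))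
    (fenchelConjugate_le_coe_iff.1 hyu.le) hnot
  have hle := fenchelConjugate_le_coe_iff.1 hq (y, u) (fenchelConjugate_le_coe_iff.2 hminorant)
  rw [real_inner_comm] at hle
  exact hlt.not_ge hle

theorem isGreatest_fenchelConjugate_fenchelConjugate (hf : ∃ x, f x < ⊤)
    (hf' : ∃ y, fenchelConjugate f y < ⊤) :
    IsGreatest {g | IsProperConvexLsc g ∧ g ≤ f} (fenchelConjugate (fenchelConjugate f)) := by
  have hle := fenchelConjugate_fenchelConjugate_le (f := f)
  refine ⟨⟨⟨⟨bot_lt_fenchelConjugate hf', hf.imp fun x hx => (hle x).trans_lt hx⟩,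
    convex_epigraph_fenchelConjugate,
    lowerSemicontinuous_iff_isClosed_epigraph.2 isClosed_epigraph_fenchelConjugate⟩, hle⟩, ?_⟩
  rintro g ⟨⟨-, hconvex, hlsc⟩, hgf⟩
  rw [le_iff_epigraph_subset, epigraph_fenchelConjugate_fenchelConjugate hf hf']
  exact closedConvexHull_min (le_iff_epigraph_subset.1 hgf) hconvex
    (lowerSemicontinuous_iff_isClosed_epigraph.1 hlsc)

end FenchelConjugate

section MarginalEpigraph

/-- The pairs `(y, t)` such that `c z ≤ t` for some `z ∈ K` with `φ z = y`. When the infima are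
attained, this is the epigraph of the marginal function `y ↦ inf {c z | z ∈ K, φ z = y}`. -/
def marginalEpigraph {X Y : Type*} (K : Set X) (φ : X → Y) (c : X → ℝ) : Set (Y × ℝ) :=
  {p | ∃ z ∈ K, φ z = p.1 ∧ c z ≤ p.2}

theorem isClosed_marginalEpigraph {X Y : Type*} [TopologicalSpace X] [TopologicalSpace Y]
    [T2Space Y] {K : Set X} {φ : X → Y} {c : X → ℝ} (hK : IsCompact K) (hφ : Continuous φ)
    (hc : Continuous c) : IsClosed (marginalEpigraph K φ c) := by
  have : CompactSpace K := isCompact_iff_compactSpace.1 hK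
  have hgraph : IsClosed {q : K × (Y × ℝ) | φ q.1 = q.2.1 ∧ c q.1 ≤ q.2.2} := by
    rw [ofPred_and]
    refine IsClosed.inter (isClosed_eq ?_ ?_) (isClosed_le ?_ ?_) <;> fun_prop
  convert isClosedMap_snd_of_compactSpace _ hgraph using 1
  ext p
  simp [marginalEpigraph, and_left_comm]

theorem convex_marginalEpigraph {X Y : Type*} [AddCommGroup X] [Module ℝ X] [AddCommGroup Y]
    [Module ℝ Y] {K : Set X} {c : X → ℝ} (φ : X →ₗ[ℝ] Y) (hc : ConvexOn ℝ K c) :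
    Convex ℝ (marginalEpigraph K φ c) := by
  have himage : marginalEpigraph K φ c =
      φ.prodMap LinearMap.id '' {p : X × ℝ | p.1 ∈ K ∧ c p.1 ≤ p.2} := by
    ext ⟨y, t⟩
    simp [marginalEpigraph, and_assoc, and_comm (a := φ _ = y)]
  rw [himage]
  exact hc.convex_epigraph.linear_image _

end MarginalEpigraph

variable {d k l : ℕ}

section Restrict

variable (K : Finset (Fin d)) (x y : E d)

theorem inner_restrict_left : inner ℝ (restrict K x) y = inner ℝ x (restrict K y) := by
  simp only [PiLp.inner_apply, restrict]
  exact Finset.sum_congr rfl fun i _ => by by_cases hi : i ∈ K <;> simp [hi]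

theorem restrict_restrict : restrict K (restrict K x) = restrict K x := by
  ext i
  by_cases hi : i ∈ K <;> simp [restrict, hi]

theorem inner_restrict_restrict :
    inner ℝ (restrict K x) (restrict K y) = inner ℝ x (restrict K y) := by
  rw [inner_restrict_left, restrict_restrict]

theorem restrict_smul (c : ℝ) : restrict K (c • x) = c • restrict K x := by
  ext i
  by_cases hi : i ∈ K <;> simp [restrict, hi]

theorem restrict_empty : restrict ∅ x = 0 := by
  ext i
  simp [restrict]

theorem restrict_univ : restrict Finset.univ x = x := by
  ext i
  simp [restrict]

theorem norm_restrict_le : ‖restrict K x‖ ≤ ‖x‖ := by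
  rw [EuclideanSpace.norm_eq, EuclideanSpace.norm_eq]
  gcongr with i
  by_cases hi : i ∈ K <;> simp [restrict, hi]

end Restrict

section GaugeNorm

theorem norm_restrict_le_gaugeNorm {K : Finset (Fin d)} (hK : K.card ≤ k) (x : E d) :
    ‖restrict K x‖ ≤ gaugeNorm k x :=
  le_ciSup (f := fun K : {K : Finset (Fin d) // K.card ≤ k} => ‖restrict K.1 x‖)
    (finite_range _).bddAbove ⟨K, hK⟩

theorem exists_norm_restrict_eq_gaugeNorm (k : ℕ) (x : E d) :
    ∃ K : Finset (Fin d), K.card ≤ k ∧ ‖restrict K x‖ = gaugeNorm k x := by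
  have : Nonempty {K : Finset (Fin d) // K.card ≤ k} := ⟨∅, by simp⟩
  obtain ⟨K, hK⟩ := exists_eq_ciSup_of_finite
    (f := fun K : {K : Finset (Fin d) // K.card ≤ k} => ‖restrict K.1 x‖)
  exact ⟨K.1, K.2, hK⟩

theorem gaugeNorm_nonneg (k : ℕ) (x : E d) : 0 ≤ gaugeNorm k x :=
  Real.iSup_nonneg fun _ => norm_nonneg _

theorem gaugeNorm_le_norm (k : ℕ) (x : E d) : gaugeNorm k x ≤ ‖x‖ :=
  Real.iSup_le (fun K => norm_restrict_le K.1 x) (norm_nonneg x)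

theorem gaugeNorm_zero_left (x : E d) : gaugeNorm 0 x = 0 := by
  obtain ⟨K, hK, hKx⟩ := exists_norm_restrict_eq_gaugeNorm 0 x
  obtain rfl : K = ∅ := by simpa using hK
  rw [← hKx, restrict_empty, norm_zero]

theorem gaugeNorm_zero_right (k : ℕ) : gaugeNorm k (0 : E d) = 0 :=
  le_antisymm (by simpa using gaugeNorm_le_norm k (0 : E d)) (gaugeNorm_nonneg k 0)

theorem gaugeNorm_self (x : E d) : gaugeNorm d x = ‖x‖ := by
  refine le_antisymm (gaugeNorm_le_norm d x) ?_
  simpa [restrict_univ] using norm_restrict_le_gaugeNorm (K := Finset.univ) (k := d) (by simp) x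

theorem gaugeNorm_mono (h : k ≤ l) (x : E d) : gaugeNorm k x ≤ gaugeNorm l x :=
  Real.iSup_le (fun K => norm_restrict_le_gaugeNorm (K.2.trans h) x) (gaugeNorm_nonneg l x)

theorem gaugeNorm_smul (k : ℕ) (c : ℝ) (x : E d) : gaugeNorm k (c • x) = |c| * gaugeNorm k x := by
  simp only [gaugeNorm, restrict_smul, norm_smul, Real.norm_eq_abs,
    Real.mul_iSup_of_nonneg (abs_nonneg c)]

theorem abs_apply_le_gaugeNorm (hk : k ≠ 0) (x : E d) (i : Fin d) : |x i| ≤ gaugeNorm k x := by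
  have hcard : ({i} : Finset (Fin d)).card ≤ k := by simpa using Nat.one_le_iff_ne_zero.2 hk
  calc |x i| = ‖restrict {i} x i‖ := by simp [restrict]
    _ ≤ ‖restrict {i} x‖ := PiLp.norm_apply_le _ i
    _ ≤ gaugeNorm k x := norm_restrict_le_gaugeNorm hcard x

theorem inner_le_gaugeNorm_mul_sum_abs (hk : k ≠ 0) (x y : E d) :
    inner ℝ y x ≤ gaugeNorm k y * ∑ i, |x i| := by
  rw [PiLp.inner_apply, Finset.mul_sum]
  refine Finset.sum_le_sum fun i _ => ?_
  calc inner ℝ (y i) (x i) ≤ |y i| * |x i| := real_inner_le_norm (y i) (x i)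
    _ ≤ gaugeNorm k y * |x i| := by gcongr; exact abs_apply_le_gaugeNorm hk y i

end GaugeNorm

section SupportNorm

theorem inner_le_supportNorm (hk : k ≠ 0) {y : E d} (hy : gaugeNorm k y ≤ 1) (x : E d) :
    inner ℝ y x ≤ supportNorm k x := by
  refine le_csSup ⟨∑ i, |x i|, ?_⟩ ⟨y, hy, rfl⟩
  rintro _ ⟨z, hz, rfl⟩
  exact (inner_le_gaugeNorm_mul_sum_abs hk x z).trans
    (mul_le_of_le_one_left (Finset.sum_nonneg fun i _ => abs_nonneg (x i)) hz)

theorem supportNorm_le {x : E d} {c : ℝ} (h : ∀ y : E d, gaugeNorm k y ≤ 1 → inner ℝ y x ≤ c) :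
    supportNorm k x ≤ c := by
  refine csSup_le ⟨_, 0, by simp [gaugeNorm_zero_right], rfl⟩ ?_
  rintro _ ⟨y, hy, rfl⟩
  exact h y hy

theorem inner_le_gaugeNorm_mul_supportNorm (hk : k ≠ 0) (x y : E d) :
    inner ℝ y x ≤ gaugeNorm k y * supportNorm k x := by
  rcases (gaugeNorm_nonneg k y).eq_or_lt with hzero | hpos
  · have h := inner_le_gaugeNorm_mul_sum_abs hk x y
    rwa [← hzero, zero_mul] at h ⊢
  · have hunit : gaugeNorm k ((gaugeNorm k y)⁻¹ • y) ≤ 1 := by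
      rw [gaugeNorm_smul, abs_of_pos (inv_pos.2 hpos), inv_mul_cancel₀ hpos.ne']
    have h := inner_le_supportNorm hk hunit x
    rwa [real_inner_smul_left, inv_mul_le_iff₀ hpos] at h

theorem norm_le_supportNorm (hk : k ≠ 0) (x : E d) : ‖x‖ ≤ supportNorm k x := by
  have hunit : gaugeNorm k (‖x‖⁻¹ • x) ≤ 1 :=
    (gaugeNorm_le_norm k _).trans (by rw [norm_smul, norm_inv, norm_norm]; exact inv_mul_le_one)
  calc ‖x‖ = inner ℝ (‖x‖⁻¹ • x) x := by
        rw [real_inner_smul_left, real_inner_self_eq_norm_mul_norm, ← mul_assoc, inv_mul_mul_self]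
    _ ≤ supportNorm k x := inner_le_supportNorm hk hunit x

theorem supportNorm_nonneg (k : ℕ) (x : E d) : 0 ≤ supportNorm k x :=
  Real.sSup_nonneg' ⟨_, ⟨0, by simp [gaugeNorm_zero_right], rfl⟩, (inner_zero_left x).ge⟩

theorem supportNorm_zero (k : ℕ) : supportNorm k (0 : E d) = 0 :=
  (supportNorm_le fun y _ => (inner_zero_right y).le).antisymm (supportNorm_nonneg k 0)

theorem supportNorm_anti (hk : k ≠ 0) (h : k ≤ l) (x : E d) : supportNorm l x ≤ supportNorm k x :=
  supportNorm_le fun y hy => inner_le_supportNorm hk ((gaugeNorm_mono h y).trans hy) x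

theorem supportNorm_self (hd : d ≠ 0) (x : E d) : supportNorm d x = ‖x‖ := by
  refine le_antisymm (supportNorm_le fun y hy => ?_) (norm_le_supportNorm hd x)
  rw [gaugeNorm_self] at hy
  exact (real_inner_le_norm y x).trans (mul_le_of_le_one_left (norm_nonneg x) hy)

theorem supportNorm_restrict_le {K : Finset (Fin d)} (hK : K.card ≤ k) (x : E d) :
    supportNorm k (restrict K x) ≤ ‖restrict K x‖ := by
  refine supportNorm_le fun y hy => ?_
  calc inner ℝ y (restrict K x) = inner ℝ (restrict K y) (restrict K x) :=
        (inner_restrict_restrict K y x).symm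
    _ ≤ ‖restrict K y‖ * ‖restrict K x‖ := real_inner_le_norm _ _
    _ ≤ ‖restrict K x‖ := mul_le_of_le_one_left (norm_nonneg _)
        ((norm_restrict_le_gaugeNorm hK y).trans hy)

theorem convexOn_supportNorm (hk : k ≠ 0) :
    ConvexOn ℝ univ (supportNorm k : E d → ℝ) := by
  refine ⟨convex_univ, fun x _ y _ a b ha hb _ => supportNorm_le fun z hz => ?_⟩
  rw [inner_add_right, real_inner_smul_right, real_inner_smul_right, smul_eq_mul, smul_eq_mul]
  gcongr <;> exact inner_le_supportNorm hk hz _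

end SupportNorm

section SupportBall

theorem supportBall_zero : supportBall d 0 = {0} := if_pos rfl

theorem mem_supportBall (hl : l ≠ 0) {x : E d} : x ∈ supportBall d l ↔ supportNorm l x ≤ 1 := by
  simp [supportBall, hl]

theorem zero_mem_supportBall (l : ℕ) : (0 : E d) ∈ supportBall d l := by
  rcases eq_or_ne l 0 with rfl | hl
  · simp [supportBall_zero]
  · simp [mem_supportBall hl, supportNorm_zero]

theorem supportBall_mono (h : k ≤ l) : supportBall d k ⊆ supportBall d l := by
  intro x hx
  rcases eq_or_ne k 0 with rfl | hk
  · obtain rfl : x = 0 := by simpa [supportBall_zero] using hx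
    exact zero_mem_supportBall l
  · rw [mem_supportBall hk] at hx
    rw [mem_supportBall (by omega)]
    exact (supportNorm_anti hk h x).trans hx

theorem supportBall_self (hd : d ≠ 0) : supportBall d d = Metric.closedBall (0 : E d) 1 := by
  ext x
  rw [mem_supportBall hd, supportNorm_self hd, mem_closedBall_zero_iff]

theorem restrict_mem_supportBall {K : Finset (Fin d)} (hK : K.card ≤ l) {x : E d}
    (hx : ‖restrict K x‖ ≤ 1) : restrict K x ∈ supportBall d l := by
  rcases eq_or_ne l 0 with rfl | hl
  · obtain rfl : K = ∅ := by simpa using hK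
    rw [restrict_empty]
    exact zero_mem_supportBall 0
  · exact (mem_supportBall hl).2 ((supportNorm_restrict_le hK x).trans hx)

theorem inner_le_gaugeNorm_of_mem_supportBall {x : E d} (hx : x ∈ supportBall d l) (y : E d) :
    inner ℝ y x ≤ gaugeNorm l y := by
  rcases eq_or_ne l 0 with rfl | hl
  · obtain rfl : x = 0 := by simpa [supportBall_zero] using hx
    simp [gaugeNorm_zero_left]
  · exact (inner_le_gaugeNorm_mul_supportNorm hl x y).trans
      (mul_le_of_le_one_right (gaugeNorm_nonneg l y) ((mem_supportBall hl).1 hx))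

theorem isGreatest_inner_supportBall (l : ℕ) (y : E d) :
    IsGreatest ((fun x => inner ℝ y x) '' supportBall d l) (gaugeNorm l y) := by
  refine ⟨?_, forall_mem_image.2 fun x hx => inner_le_gaugeNorm_of_mem_supportBall hx y⟩
  obtain ⟨K, hK, hKy⟩ := exists_norm_restrict_eq_gaugeNorm l y
  refine ⟨restrict K (‖restrict K y‖⁻¹ • y), restrict_mem_supportBall hK ?_, ?_⟩
  · rw [restrict_smul, norm_smul, norm_inv, norm_norm]
    exact inv_mul_le_one
  · dsimp only
    rw [restrict_smul, real_inner_smul_right, ← inner_restrict_restrict,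
      real_inner_self_eq_norm_mul_norm, ← mul_assoc, inv_mul_mul_self, hKy]

end SupportBall

section StepFunction

theorem stepL0_zero : stepL0 d 0 = 0 := if_pos rfl

theorem stepL0_of_mem_diff (hl : 1 ≤ l) (hld : l ≤ d) {x : E d}
    (hx : x ∈ supportBall d l \ supportBall d (l - 1)) : stepL0 d x = ((l : ℝ) : EReal) := by
  classical
  have hx0 : x ≠ 0 := fun h => hx.2 (h ▸ zero_mem_supportBall _)
  have hex : ∃ l : ℕ, 1 ≤ l ∧ l ≤ d ∧ x ∈ supportBall d l \ supportBall d (l - 1) :=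
    ⟨l, hl, hld, hx⟩
  have hfind : Nat.find hex = l := by
    refine le_antisymm (Nat.find_min' hex ⟨hl, hld, hx⟩) ?_
    by_contra! hlt
    exact hx.2 (supportBall_mono (Nat.le_sub_one_of_lt hlt) (Nat.find_spec hex).2.2.1)
  simp only [stepL0, if_neg hx0, dif_pos hex]
  rw [← hfind]

theorem stepL0_le_of_mem_supportBall (hl : l ≤ d) {x : E d} (hx : x ∈ supportBall d l) :
    stepL0 d x ≤ ((l : ℝ) : EReal) := by
  induction l with
  | zero =>
    obtain rfl : x = 0 := by simpa [supportBall_zero] using hx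
    simp [stepL0_zero]
  | succ k ih =>
    by_cases hk : x ∈ supportBall d k
    · refine (ih (by omega) hk).trans (EReal.coe_le_coe_iff.2 ?_)
      exact_mod_cast k.le_succ
    · exact (stepL0_of_mem_diff (by omega) hl ⟨hx, hk⟩).le

theorem epigraph_stepL0 :
    epigraph (stepL0 d) = ⋃ l : Fin (d + 1), supportBall d (l : ℕ) ×ˢ Ici (((l : ℕ) : ℝ)) := by
  classical
  ext ⟨x, t⟩
  simp only [mem_iUnion, mem_prod, mem_Ici]
  constructor
  · intro (ht : stepL0 d x ≤ t)
    unfold stepL0 at ht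
    split_ifs at ht with hx0 hex
    · exact ⟨0, hx0 ▸ zero_mem_supportBall _, by simpa using ht⟩
    · obtain ⟨-, hld, hx, -⟩ := Nat.find_spec hex
      exact ⟨⟨Nat.find hex, Nat.lt_succ_of_le hld⟩, hx, EReal.coe_le_coe_iff.1 ht⟩
    · exact absurd ht (EReal.coe_lt_top t).not_ge
  · rintro ⟨l, hx, ht⟩
    exact (stepL0_le_of_mem_supportBall l.is_le hx).trans (EReal.coe_le_coe_iff.2 ht)

theorem stepL0_of_notMem_supportBall {x : E d} (hx : x ∉ supportBall d d) : stepL0 d x = ⊤ := by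
  refine top_le_iff.1 (EReal.le_of_forall_lt_iff_le.1 fun t ht => ?_)
  have hmem : (x, t) ∈ epigraph (stepL0 d) := ht.le
  rw [epigraph_stepL0] at hmem
  obtain ⟨l, hxl, -⟩ := mem_iUnion.1 hmem
  exact absurd (supportBall_mono l.is_le hxl) hx

end StepFunction

section Biconjugate

theorem fenchelConjugate_stepL0_le_coe_iff {y : E d} {u : ℝ} :
    fenchelConjugate (stepL0 d) y ≤ u ↔ ∀ l ≤ d, gaugeNorm l y - l ≤ u := by
  rw [fenchelConjugate_le_coe_iff, epigraph_stepL0]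
  constructor
  · intro h l hl
    obtain ⟨x, hx, hxy⟩ := (isGreatest_inner_supportBall l y).1
    rw [← hxy]
    exact h (x, l) (mem_iUnion.2 ⟨⟨l, Nat.lt_succ_of_le hl⟩, hx, self_mem_Ici⟩)
  · rintro h ⟨x, t⟩ hp
    obtain ⟨l, hx, ht⟩ := mem_iUnion.1 hp
    exact (sub_le_sub (inner_le_gaugeNorm_of_mem_supportBall hx y) ht).trans (h l l.is_le)

theorem fenchelConjugate_stepL0 (y : E d) :
    fenchelConjugate (stepL0 d) y =
      ⨆ l : Fin (d + 1), ((gaugeNorm (l : ℕ) y - (l : ℕ) : ℝ) : EReal) := by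
  have hle (u : ℝ) : fenchelConjugate (stepL0 d) y ≤ u ↔
      ⨆ l : Fin (d + 1), ((gaugeNorm (l : ℕ) y - (l : ℕ) : ℝ) : EReal) ≤ u := by
    simp only [fenchelConjugate_stepL0_le_coe_iff, iSup_le_iff, EReal.coe_le_coe_iff,
      Fin.forall_iff, Nat.lt_succ_iff]
  exact le_antisymm (EReal.le_of_forall_lt_iff_le.1 fun u hu => (hle u).2 hu.le)
    (EReal.le_of_forall_lt_iff_le.1 fun u hu => (hle u).1 hu.le)

theorem calL0_eq_fenchelConjugate_fenchelConjugate :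
    calL0 d = fenchelConjugate (fenchelConjugate (stepL0 d)) :=
  congrArg fenchelConjugate (funext fun y => (fenchelConjugate_stepL0 y).symm)

theorem exists_stepL0_lt_top : ∃ x, stepL0 d x < ⊤ :=
  ⟨0, stepL0_zero.trans_lt EReal.zero_lt_top⟩

theorem exists_fenchelConjugate_stepL0_lt_top : ∃ y, fenchelConjugate (stepL0 d) y < ⊤ := by
  refine ⟨0, lt_of_le_of_lt ?_ (EReal.coe_lt_top 0)⟩
  exact fenchelConjugate_stepL0_le_coe_iff.2 fun l _ => by simp [gaugeNorm_zero_right]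

theorem epigraph_calL0 : epigraph (calL0 d) = closedConvexHull ℝ (epigraph (stepL0 d)) := by
  rw [calL0_eq_fenchelConjugate_fenchelConjugate]
  exact epigraph_fenchelConjugate_fenchelConjugate exists_stepL0_lt_top
    exists_fenchelConjugate_stepL0_lt_top

theorem isGreatest_calL0 :
    IsGreatest {f : E d → EReal | IsProperConvexLsc f ∧ f ≤ stepL0 d} (calL0 d) := by
  rw [calL0_eq_fenchelConjugate_fenchelConjugate]
  exact isGreatest_fenchelConjugate_fenchelConjugate exists_stepL0_lt_top
    exists_fenchelConjugate_stepL0_lt_top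

end Biconjugate

section Decompositions

/-- The families `x^(1), …, x^(d)` with `∑ ‖x^(l)‖_(l) ≤ 1`, the entry of index `i : Fin d` being
`x^(i+1)`; `decompositions x` consists of those that sum to `x`. -/
def admissibleFamilies (d : ℕ) : Set (Fin d → E d) :=
  {z | ∑ i : Fin d, supportNorm ((i : ℕ) + 1) (z i) ≤ 1}

theorem convexOn_sum_mul_supportNorm {w : Fin d → ℝ} (hw : ∀ i, 0 ≤ w i) :
    ConvexOn ℝ univ fun z : Fin d → E d => ∑ i, w i * supportNorm ((i : ℕ) + 1) (z i) := by
  refine ⟨convex_univ, fun x _ y _ a b ha hb hab => ?_⟩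
  simp only [smul_eq_mul, Finset.mul_sum, ← Finset.sum_add_distrib, mul_left_comm _ (w _),
    ← mul_add]
  gcongr with i
  · exact hw i
  · exact (convexOn_supportNorm i.val.succ_ne_zero).2 trivial trivial ha hb hab

theorem convexOn_cost : ConvexOn ℝ univ (cost : (Fin d → E d) → ℝ) :=
  convexOn_sum_mul_supportNorm fun i => by positivity

theorem convexOn_sum_supportNorm :
    ConvexOn ℝ univ fun z : Fin d → E d => ∑ i : Fin d, supportNorm ((i : ℕ) + 1) (z i) := by
  simpa using convexOn_sum_mul_supportNorm (d := d) (w := 1) fun _ => zero_le_one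

theorem convex_admissibleFamilies : Convex ℝ (admissibleFamilies d) := by
  simpa [admissibleFamilies] using convexOn_sum_supportNorm.convex_le (1 : ℝ)

theorem isCompact_admissibleFamilies : IsCompact (admissibleFamilies d) := by
  refine (isCompact_closedBall (0 : Fin d → E d) 1).of_isClosed_subset
    (isClosed_le convexOn_sum_supportNorm.locallyLipschitz.continuous continuous_const)
    fun z hz => ?_
  rw [mem_closedBall_zero_iff, pi_norm_le_iff_of_nonneg zero_le_one]
  intro i
  calc ‖z i‖ ≤ supportNorm ((i : ℕ) + 1) (z i) := norm_le_supportNorm i.val.succ_ne_zero (z i)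
    _ ≤ ∑ j : Fin d, supportNorm ((j : ℕ) + 1) (z j) :=
        Finset.single_le_sum (fun (j : Fin d) _ => supportNorm_nonneg (j + 1) (z j))
          (Finset.mem_univ i)
    _ ≤ 1 := hz

/-- The pairs `(x, t)` such that `x` has a decomposition of cost at most `t`. -/
def decompositionEpigraph (d : ℕ) : Set (E d × ℝ) :=
  marginalEpigraph (admissibleFamilies d) (fun z => ∑ i, z i) cost

theorem mem_decompositionEpigraph {x : E d} {t : ℝ} :
    (x, t) ∈ decompositionEpigraph d ↔ ∃ z ∈ decompositions x, cost z ≤ t := by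
  simp only [decompositionEpigraph, marginalEpigraph, admissibleFamilies, decompositions,
    mem_ofPred_eq, and_assoc]

theorem isClosed_decompositionEpigraph : IsClosed (decompositionEpigraph d) :=
  isClosed_marginalEpigraph isCompact_admissibleFamilies (by fun_prop)
    convexOn_cost.locallyLipschitz.continuous

theorem convex_decompositionEpigraph : Convex ℝ (decompositionEpigraph d) := by
  have hsum : (fun z : Fin d → E d => ∑ i, z i) = ∑ i, LinearMap.proj (R := ℝ) i := by
    ext; simp
  rw [decompositionEpigraph, hsum]
  exact convex_marginalEpigraph _ (convexOn_cost.subset (subset_univ _) convex_admissibleFamilies)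

theorem sum_apply_single {ι A B : Type*} [Fintype ι] [DecidableEq ι] [Zero A] [AddCommMonoid B]
    (F : ι → A → B) (hF : ∀ i, F i 0 = 0) (j : ι) (x : A) :
    ∑ i, F i (Pi.single (M := fun _ => A) j x i) = F j x := by
  rw [Fintype.sum_eq_single j fun i hi => by rw [Pi.single_eq_of_ne hi, hF], Pi.single_eq_same]

theorem single_mem_decompositions {i : Fin d} {x : E d} (hx : supportNorm ((i : ℕ) + 1) x ≤ 1) :
    Pi.single i x ∈ decompositions x :=
  ⟨(sum_apply_single _ (fun _ => supportNorm_zero _) i x).trans_le hx,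
    sum_apply_single (fun _ => id) (fun _ => rfl) i x⟩

theorem cost_single (i : Fin d) (x : E d) :
    cost (Pi.single i x) = ((i : ℕ) + 1 : ℝ) * supportNorm ((i : ℕ) + 1) x :=
  sum_apply_single (fun (j : Fin d) v => ((j : ℕ) + 1 : ℝ) * supportNorm ((j : ℕ) + 1) v)
    (fun j => by rw [supportNorm_zero, mul_zero]) i x

theorem epigraph_stepL0_subset_decompositionEpigraph :
    epigraph (stepL0 d) ⊆ decompositionEpigraph d := by
  rw [epigraph_stepL0]
  rintro ⟨x, t⟩ hp
  obtain ⟨l, hx, ht⟩ := mem_iUnion.1 hp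
  refine mem_decompositionEpigraph.2 ?_
  induction l using Fin.cases with
  | zero =>
    obtain rfl : x = 0 := by simpa [supportBall_zero] using hx
    refine ⟨0, ⟨?_, by simp⟩, ?_⟩
    · simp [supportNorm_zero]
    · simpa [cost, supportNorm_zero] using ht
  | succ i =>
    replace hx := (mem_supportBall i.val.succ_ne_zero).1 hx
    refine ⟨Pi.single i x, single_mem_decompositions hx, ?_⟩
    rw [cost_single]
    refine (mul_le_of_le_one_right (by positivity) hx).trans ?_
    simpa using ht

theorem calL0_le_cost {x : E d} {z : Fin d → E d} (hz : z ∈ decompositions x) :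
    calL0 d x ≤ cost z := by
  obtain ⟨hz1, rfl⟩ := hz
  rw [calL0_eq_fenchelConjugate_fenchelConjugate, fenchelConjugate_le_coe_iff]
  rintro ⟨y, u⟩ hyu
  replace hyu := fenchelConjugate_stepL0_le_coe_iff.1 hyu
  have hu : 0 ≤ u := by simpa [gaugeNorm_zero_left] using hyu 0 d.zero_le
  have hterm (i : Fin d) : inner ℝ (z i) y ≤
      (u + ((i : ℕ) + 1)) * supportNorm ((i : ℕ) + 1) (z i) := by
    have hi := hyu ((i : ℕ) + 1) i.2
    push_cast at hi
    rw [real_inner_comm]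
    refine (inner_le_gaugeNorm_mul_supportNorm i.val.succ_ne_zero (z i) y).trans ?_
    exact mul_le_mul_of_nonneg_right (by linarith) (supportNorm_nonneg _ _)
  rw [sub_le_iff_le_add']
  calc inner ℝ (∑ i, z i) y
      ≤ ∑ i : Fin d, (u + ((i : ℕ) + 1)) * supportNorm ((i : ℕ) + 1) (z i) := by
        rw [sum_inner]
        exact Finset.sum_le_sum fun i _ => hterm i
    _ = u * ∑ i : Fin d, supportNorm ((i : ℕ) + 1) (z i) + cost z := by
        simp only [cost, add_mul, Finset.sum_add_distrib, Finset.mul_sum]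
    _ ≤ u + cost z := by
        gcongr
        exact mul_le_of_le_one_right hu hz1

theorem calL0_le_coe_iff {x : E d} {t : ℝ} :
    calL0 d x ≤ t ↔ ∃ z ∈ decompositions x, cost z ≤ t := by
  constructor
  · intro h
    have hmem : (x, t) ∈ epigraph (calL0 d) := h
    rw [epigraph_calL0] at hmem
    exact mem_decompositionEpigraph.1 (closedConvexHull_min
      epigraph_stepL0_subset_decompositionEpigraph convex_decompositionEpigraph
      isClosed_decompositionEpigraph hmem)
  · rintro ⟨z, hz, hzt⟩
    exact (calL0_le_cost hz).trans (EReal.coe_le_coe_iff.2 hzt)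

theorem exists_calL0_eq_cost {x : E d} (hx : calL0 d x < ⊤) :
    ∃ z ∈ decompositions x, calL0 d x = cost z := by
  have hcoe := EReal.coe_toReal hx.ne (isGreatest_calL0.1.1.1.1 x).ne'
  obtain ⟨z, hz, hzt⟩ := calL0_le_coe_iff.1 hcoe.ge
  exact ⟨z, hz, (calL0_le_cost hz).antisymm (hcoe ▸ EReal.coe_le_coe_iff.2 hzt)⟩

theorem calL0_eq_sInf_cost (x : E d) :
    calL0 d x = sInf ((fun z => (cost z : EReal)) '' decompositions x) := by
  refine le_antisymm (le_sInf (forall_mem_image.2 fun z hz => calL0_le_cost hz)) ?_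
  rcases (le_top : calL0 d x ≤ ⊤).lt_or_eq with hlt | htop
  · obtain ⟨z, hz, hzx⟩ := exists_calL0_eq_cost hlt
    exact hzx ▸ sInf_le (mem_image_of_mem _ hz)
  · exact htop ▸ le_top

end Decompositions

end Capra

theorem mainTheorem3 (d : ℕ) (hd : 1 ≤ d) :
    -- the chain of unit balls
    ((∀ l : ℕ, 1 ≤ l → l ≤ d → Capra.supportBall d (l - 1) ⊆ Capra.supportBall d l) ∧
      Capra.supportBall d d = Metric.closedBall (0 : Capra.E d) 1) ∧
    -- the epigraph of `𝓛₀`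
    Capra.epigraph (Capra.calL0 d) =
      closedConvexHull ℝ
        (⋃ l : Fin (d + 1), Capra.supportBall d (l : ℕ) ×ˢ Set.Ici (((l : ℕ) : ℝ))) ∧
    -- the function `L₀` takes the prescribed values
    (Capra.stepL0 d 0 = 0 ∧
      (∀ l : ℕ, 1 ≤ l → l ≤ d →
        ∀ x ∈ Capra.supportBall d l \ Capra.supportBall d (l - 1),
          Capra.stepL0 d x = ((l : ℝ) : EReal)) ∧
      ∀ x ∉ Metric.closedBall (0 : Capra.E d) 1, Capra.stepL0 d x = ⊤) ∧
    -- `𝓛₀` is the largest proper convex lsc function below `L₀`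
    IsGreatest {f : Capra.E d → EReal | Capra.IsProperConvexLsc f ∧ f ≤ Capra.stepL0 d}
      (Capra.calL0 d) ∧
    -- the minimum formula, the minimum over the empty set being `+∞`
    ∀ x : Capra.E d,
      Capra.calL0 d x =
          sInf ((fun z => (Capra.cost z : EReal)) '' Capra.decompositions x) ∧
        ((Capra.decompositions x).Nonempty →
          ∃ z ∈ Capra.decompositions x, Capra.calL0 d x = (Capra.cost z : EReal)) := by
  have hd0 : d ≠ 0 := Nat.one_le_iff_ne_zero.1 hd
  refine ⟨⟨fun l _ _ => Capra.supportBall_mono (Nat.sub_le l 1), Capra.supportBall_self hd0⟩,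
    Capra.epigraph_stepL0 ▸ Capra.epigraph_calL0,
    ⟨Capra.stepL0_zero, fun l hl hld x hx => Capra.stepL0_of_mem_diff hl hld hx, fun x hx => ?_⟩,
    Capra.isGreatest_calL0, fun x => ⟨Capra.calL0_eq_sInf_cost x, ?_⟩⟩
  · exact Capra.stepL0_of_notMem_supportBall (Capra.supportBall_self hd0 ▸ hx)
  · rintro ⟨z, hz⟩
    exact Capra.exists_calL0_eq_cost ((Capra.calL0_le_cost hz).trans_lt (EReal.coe_lt_top _))
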